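/- **Theorem (Coherence for strong symmetric monoidal functors).** Let $F\colon \mathcal C\to\mathcal D$ be a strong symmetric monoidal functor between symmetric monoidal categories. *Formal morphisms.* For a set $T$, let $\mathrm{Fr}(T)$ be the free symmetric monoidal category on $T$, whose objects are parenthesized words in elements of $T$ and a formal unit $I$. Let $\mathcal F_T\colon \mathrm{Fr}(T)\to \mathrm{Fr}_{F}(T)$ be the free strong symmetric monoidal functor on $T$. The objects of $\mathrm{Fr}_F(T)$ are parenthesized words in formal units and terms $\mathcal F_T(W)$ with $W\in \mathrm{Fr}(T)$. Its morphisms are generated under composition and tensor product by associators, unitors and symmetries, the morphisms $\mathcal F_T(f)$ for $f$ in $\mathrm{Fr}(T)$, and isomorphisms $i\colon I\to \mathcal F_T(I)$ and $m\colon \mathcal F_T(W)\otimes \mathcal F_T(W')\to \mathcal F_T(W\otimes W')$, subject to the axioms of a symmetric monoidal category and of a strong symmetric monoidal functor. Taking $T=\mathrm{ob}\,\mathcal C$, the functor $F$ determines a strict symmetric monoidal functor $\mathrm{ev}_F\colon \mathrm{Fr}_F(\mathrm{ob}\,\mathcal C)\to\mathcal D$, with $\mathrm{ev}_F\circ\mathcal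 F_T = F\circ \varepsilon$, where $\varepsilon\colon \mathrm{Fr}(\mathrm{ob}\,\mathcal C)\to\mathcal C$ is the counit. A morphism of $\mathrm{Fr}_F(\mathrm{ob}\,\mathcal C)$ is called a formal morphism. If $X_1,\dots,X_n$ are the objects of $\mathcal C$ that occur in its source word, from left to right and ignoring formal units, then its underlying permutation is the permutation of $\{1,\dots,n\}$ by which it rearranges the $X_i$: symmetries act by the corresponding block transpositions and all other structure maps act trivially. *Formal diagrams.* A formal diagram of $F$ is a diagram in $\mathcal D$, indexed by a directed graph, together with a lift along $\mathrm{ev}_F$. It is expected to commute if, for any two parallel composites in the diagram, the underlying permutations of their lifts agree. Then: 1. Every formal diagram of $F$ that is expected to commute commutes. 2. If $f,g\colon V\to W$ are parallel formal morphisms with the same underlying permutation, then $\mathrm{ev}_F(f)=\mathrm{ev}_F(g)$ in $\mathcal D$. 3. Every formal diagram of $F$ in which the objects $X_1,\dots,X_n$ occurring in each word are distinct commutes. -/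

import Mathlib

open CategoryTheory MonoidalCategory

/-! ### The free symmetric monoidal category on a set -/

/-- Objects of the free symmetric monoidal category on `T`: parenthesized words
in elements of `T` and formal units. -/
inductive FreeSMC (T : Type*) : Type _
  | of : T → FreeSMC T
  | unit : FreeSMC T
  | tensor : FreeSMC T → FreeSMC T → FreeSMC T

namespace FreeSMC

/-- Formal composites of expanded instances of associators, unitors and symmetries. -/
inductive Pre {T : Type*} : FreeSMC T → FreeSMC T → Type _
  | id (X : FreeSMC T) : Pre X X
  | comp {X Y Z : FreeSMC T} (f : Pre X Y) (g : Pre Y Z) : Pre X Z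
  | tensor {X Y X' Y' : FreeSMC T} (f : Pre X Y) (g : Pre X' Y') :
      Pre (X.tensor X') (Y.tensor Y')
  | assoc (X Y Z : FreeSMC T) : Pre ((X.tensor Y).tensor Z) (X.tensor (Y.tensor Z))
  | assocInv (X Y Z : FreeSMC T) : Pre (X.tensor (Y.tensor Z)) ((X.tensor Y).tensor Z)
  | left (X : FreeSMC T) : Pre (unit.tensor X) X
  | leftInv (X : FreeSMC T) : Pre X (unit.tensor X)
  | right (X : FreeSMC T) : Pre (X.tensor unit) X
  | rightInv (X : FreeSMC T) : Pre X (X.tensor unit)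
  | symm (X Y : FreeSMC T) : Pre (X.tensor Y) (Y.tensor X)

/-- The congruence generated by the axioms of a symmetric monoidal category. -/
inductive Rel {T : Type*} : ∀ {X Y : FreeSMC T}, Pre X Y → Pre X Y → Prop
  | refl {X Y : FreeSMC T} (f : Pre X Y) : Rel f f
  | symm {X Y : FreeSMC T} {f g : Pre X Y} : Rel f g → Rel g f
  | trans {X Y : FreeSMC T} {f g h : Pre X Y} : Rel f g → Rel g h → Rel f h
  | comp {X Y Z : FreeSMC T} {f f' : Pre X Y} {g g' : Pre Y Z} :
      Rel f f' → Rel g g' → Rel (f.comp g) (f'.comp g')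
  | tensor {X Y X' Y' : FreeSMC T} {f f' : Pre X Y} {g g' : Pre X' Y'} :
      Rel f f' → Rel g g' → Rel (f.tensor g) (f'.tensor g')
  | id_comp {X Y : FreeSMC T} (f : Pre X Y) : Rel ((Pre.id X).comp f) f
  | comp_id {X Y : FreeSMC T} (f : Pre X Y) : Rel (f.comp (Pre.id Y)) f
  | comp_assoc {W X Y Z : FreeSMC T} (f : Pre W X) (g : Pre X Y) (h : Pre Y Z) :
      Rel ((f.comp g).comp h) (f.comp (g.comp h))
  | tensor_id (X Y : FreeSMC T) : Rel ((Pre.id X).tensor (Pre.id Y)) (Pre.id (X.tensor Y))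
  | tensor_comp {X Y Z X' Y' Z' : FreeSMC T} (f : Pre X Y) (f' : Pre X' Y')
      (g : Pre Y Z) (g' : Pre Y' Z') :
      Rel ((f.tensor f').comp (g.tensor g')) ((f.comp g).tensor (f'.comp g'))
  | assoc_assocInv (X Y Z : FreeSMC T) :
      Rel ((Pre.assoc X Y Z).comp (Pre.assocInv X Y Z)) (Pre.id _)
  | assocInv_assoc (X Y Z : FreeSMC T) :
      Rel ((Pre.assocInv X Y Z).comp (Pre.assoc X Y Z)) (Pre.id _)
  | left_leftInv (X : FreeSMC T) : Rel ((Pre.left X).comp (Pre.leftInv X)) (Pre.id _)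
  | leftInv_left (X : FreeSMC T) : Rel ((Pre.leftInv X).comp (Pre.left X)) (Pre.id _)
  | right_rightInv (X : FreeSMC T) : Rel ((Pre.right X).comp (Pre.rightInv X)) (Pre.id _)
  | rightInv_right (X : FreeSMC T) : Rel ((Pre.rightInv X).comp (Pre.right X)) (Pre.id _)
  | symm_symm (X Y : FreeSMC T) : Rel ((Pre.symm X Y).comp (Pre.symm Y X)) (Pre.id _)
  | assoc_naturality {X₁ X₂ X₃ Y₁ Y₂ Y₃ : FreeSMC T}
      (f₁ : Pre X₁ Y₁) (f₂ : Pre X₂ Y₂) (f₃ : Pre X₃ Y₃) :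
      Rel (((f₁.tensor f₂).tensor f₃).comp (Pre.assoc Y₁ Y₂ Y₃))
        ((Pre.assoc X₁ X₂ X₃).comp (f₁.tensor (f₂.tensor f₃)))
  | left_naturality {X Y : FreeSMC T} (f : Pre X Y) :
      Rel (((Pre.id unit).tensor f).comp (Pre.left Y)) ((Pre.left X).comp f)
  | right_naturality {X Y : FreeSMC T} (f : Pre X Y) :
      Rel ((f.tensor (Pre.id unit)).comp (Pre.right Y)) ((Pre.right X).comp f)
  | symm_naturality {X Y X' Y' : FreeSMC T} (f : Pre X Y) (g : Pre X' Y') :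
      Rel ((f.tensor g).comp (Pre.symm Y Y')) ((Pre.symm X X').comp (g.tensor f))
  | pentagon (W X Y Z : FreeSMC T) :
      Rel (((Pre.assoc W X Y).tensor (Pre.id Z)).comp
          ((Pre.assoc W (X.tensor Y) Z).comp ((Pre.id W).tensor (Pre.assoc X Y Z))))
        ((Pre.assoc (W.tensor X) Y Z).comp (Pre.assoc W X (Y.tensor Z)))
  | triangle (X Y : FreeSMC T) :
      Rel ((Pre.assoc X unit Y).comp ((Pre.id X).tensor (Pre.left Y)))
        ((Pre.right X).tensor (Pre.id Y))
  | symm_unit (X : FreeSMC T) :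
      Rel ((Pre.symm X unit).comp (Pre.left X)) (Pre.right X)
  | hexagon (X Y Z : FreeSMC T) :
      Rel ((Pre.assoc X Y Z).comp ((Pre.symm X (Y.tensor Z)).comp (Pre.assoc Y Z X)))
        (((Pre.symm X Y).tensor (Pre.id Z)).comp
          ((Pre.assoc Y X Z).comp ((Pre.id Y).tensor (Pre.symm X Z))))

instance homSetoid {T : Type*} (X Y : FreeSMC T) : Setoid (Pre X Y) :=
  ⟨Rel, ⟨Rel.refl, Rel.symm, Rel.trans⟩⟩

instance category {T : Type*} : Category (FreeSMC T) where
  Hom X Y := Quotient (homSetoid X Y)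
  id X := ⟦Pre.id X⟧
  comp := Quotient.map₂ Pre.comp (fun _ _ hf _ _ hg => Rel.comp hf hg)
  id_comp := by rintro X Y ⟨f⟩; exact Quotient.sound (Rel.id_comp f)
  comp_id := by rintro X Y ⟨f⟩; exact Quotient.sound (Rel.comp_id f)
  assoc := by rintro W X Y Z ⟨f⟩ ⟨g⟩ ⟨h⟩; exact Quotient.sound (Rel.comp_assoc f g h)

/-- The tensor product of morphisms. -/
def tensorMap {T : Type*} {X Y X' Y' : FreeSMC T} (f : X ⟶ Y) (g : X' ⟶ Y') :
    X.tensor X' ⟶ Y.tensor Y' :=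
  Quotient.map₂ Pre.tensor (fun _ _ hf _ _ hg => Rel.tensor hf hg) f g

instance monoidalStruct {T : Type*} : MonoidalCategoryStruct (FreeSMC T) where
  tensorObj := tensor
  whiskerLeft X _ _ f := tensorMap (𝟙 X) f
  whiskerRight f Y := tensorMap f (𝟙 Y)
  tensorHom f g := tensorMap f g
  tensorUnit := unit
  associator X Y Z := ⟨⟦Pre.assoc X Y Z⟧, ⟦Pre.assocInv X Y Z⟧,
    Quotient.sound (Rel.assoc_assocInv X Y Z), Quotient.sound (Rel.assocInv_assoc X Y Z)⟩
  leftUnitor X := ⟨⟦Pre.left X⟧, ⟦Pre.leftInv X⟧,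
    Quotient.sound (Rel.left_leftInv X), Quotient.sound (Rel.leftInv_left X)⟩
  rightUnitor X := ⟨⟦Pre.right X⟧, ⟦Pre.rightInv X⟧,
    Quotient.sound (Rel.right_rightInv X), Quotient.sound (Rel.rightInv_right X)⟩

instance monoidal {T : Type*} : MonoidalCategory (FreeSMC T) :=
  MonoidalCategory.ofTensorHom
    (id_tensorHom_id := fun X Y => Quotient.sound (Rel.tensor_id X Y))
    (id_tensorHom := fun _ _ _ _ => rfl)
    (tensorHom_id := fun _ _ => rfl)
    (tensorHom_comp_tensorHom := by
      rintro _ _ _ _ _ _ ⟨f⟩ ⟨f'⟩ ⟨g⟩ ⟨g'⟩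
      exact Quotient.sound (Rel.tensor_comp f f' g g'))
    (associator_naturality := by
      rintro _ _ _ _ _ _ ⟨f⟩ ⟨g⟩ ⟨h⟩
      exact Quotient.sound (Rel.assoc_naturality f g h))
    (leftUnitor_naturality := by
      rintro _ _ ⟨f⟩
      exact Quotient.sound (Rel.left_naturality f))
    (rightUnitor_naturality := by
      rintro _ _ ⟨f⟩
      exact Quotient.sound (Rel.right_naturality f))
    (pentagon := fun W X Y Z => Quotient.sound (Rel.pentagon W X Y Z))
    (triangle := fun X Y => Quotient.sound (Rel.triangle X Y))

/-- The symmetry isomorphism. -/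
def symmIso {T : Type*} (X Y : FreeSMC T) : X ⊗ Y ≅ Y ⊗ X :=
  ⟨⟦Pre.symm X Y⟧, ⟦Pre.symm Y X⟧,
    Quotient.sound (Rel.symm_symm X Y), Quotient.sound (Rel.symm_symm Y X)⟩

theorem symmIso_hexagon {T : Type*} (X Y Z : FreeSMC T) :
    (α_ X Y Z).hom ≫ (symmIso X (Y ⊗ Z)).hom ≫ (α_ Y Z X).hom =
      (symmIso X Y).hom ▷ Z ≫ (α_ Y X Z).hom ≫ Y ◁ (symmIso X Z).hom :=
  Quotient.sound (Rel.hexagon X Y Z)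

instance symmetric {T : Type*} : SymmetricCategory (FreeSMC T) where
  braiding := symmIso
  braiding_naturality_right X Y Z f := by
    induction f using Quotient.inductionOn with
    | _ f => exact Quotient.sound (Rel.symm_naturality (Pre.id X) f)
  braiding_naturality_left f Z := by
    induction f using Quotient.inductionOn with
    | _ f => exact Quotient.sound (Rel.symm_naturality f (Pre.id Z))
  hexagon_forward := symmIso_hexagon
  hexagon_reverse X Y Z := by
    have h := symmIso_hexagon Z X Y
    have e : ∀ A B : FreeSMC T, (symmIso A B).inv = (symmIso B A).hom := fun _ _ => rfl
    have h' : ((α_ Z X Y) ≪≫ symmIso Z (X ⊗ Y) ≪≫ (α_ X Y Z)).inv =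
        (whiskerRightIso (symmIso Z X) Y ≪≫ (α_ X Z Y) ≪≫ whiskerLeftIso X (symmIso Z Y)).inv := by
      congr 1
      ext
      exact h
    simpa [e] using h'
  symmetry X Y := (symmIso X Y).hom_inv_id

section lift

variable {T : Type*} {C : Type*} [Category C] [MonoidalCategory C] [SymmetricCategory C]
  (φ : T → C)

/-- The value of a formal word in a symmetric monoidal category. -/
def liftObj : FreeSMC T → C
  | of t => φ t
  | unit => 𝟙_ C
  | tensor X Y => liftObj X ⊗ liftObj Y

/-- The value of a formal composite in a symmetric monoidal category. -/
def liftPre : ∀ {X Y : FreeSMC T}, Pre X Y → (liftObj φ X ⟶ liftObj φ Y)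
  | _, _, .id _ => 𝟙 _
  | _, _, .comp f g => liftPre f ≫ liftPre g
  | _, _, .tensor f g => liftPre f ⊗ₘ liftPre g
  | _, _, .assoc _ _ _ => (α_ _ _ _).hom
  | _, _, .assocInv _ _ _ => (α_ _ _ _).inv
  | _, _, .left _ => (λ_ _).hom
  | _, _, .leftInv _ => (λ_ _).inv
  | _, _, .right _ => (ρ_ _).hom
  | _, _, .rightInv _ => (ρ_ _).inv
  | _, _, .symm _ _ => (β_ _ _).hom

theorem liftPre_sound {X Y : FreeSMC T} {f g : Pre X Y} (h : Rel f g) :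
    liftPre φ f = liftPre φ g := by
  induction h with
  | refl f => rfl
  | symm _ ih => exact ih.symm
  | trans _ _ ih₁ ih₂ => exact ih₁.trans ih₂
  | comp _ _ ih₁ ih₂ => simp only [liftPre, ih₁, ih₂]
  | tensor _ _ ih₁ ih₂ => exact congrArg₂ (fun a b => a ⊗ₘ b) ih₁ ih₂
  | _ => simp [liftPre, liftObj]

/-- The strict symmetric monoidal functor from the free symmetric monoidal category on `T`
that extends `φ`; for `φ = id` on the objects of `C` this is the counit. -/
def lift : FreeSMC T ⥤ C where
  obj := liftObj φ
  map f := Quotient.lift (liftPre φ) (fun _ _ h => liftPre_sound φ h) f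
  map_id _ := rfl
  map_comp := by rintro _ _ _ ⟨f⟩ ⟨g⟩; rfl

end lift

section perm

variable {T : Type*}

/-- The set of positions in a word occupied by elements of `T` (formal units are ignored). -/
def Pos : FreeSMC T → Type
  | of _ => Unit
  | unit => Empty
  | tensor X Y => Pos X ⊕ Pos Y

/-- The element of `T` at a given position. -/
def letterAt : ∀ X : FreeSMC T, Pos X → T
  | of t, _ => t
  | unit, p => nomatch p
  | tensor X Y, p => Sum.elim (letterAt X) (letterAt Y) p

/-- The number `n` of elements of `T` in a word. -/
def len : FreeSMC T → ℕ
  | of _ => 1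
  | unit => 0
  | tensor X Y => len X + len Y

/-- The positions are numbered from left to right. -/
def posEquiv : ∀ X : FreeSMC T, Pos X ≃ Fin (len X)
  | of _ => finOneEquiv.symm
  | unit => Equiv.equivOfIsEmpty Empty (Fin 0)
  | tensor X Y => (Equiv.sumCongr (posEquiv X) (posEquiv Y)).trans finSumFinEquiv

/-- The motion of positions along a formal composite. -/
def posPre : ∀ {X Y : FreeSMC T}, Pre X Y → (Pos X ≃ Pos Y)
  | _, _, .id _ => Equiv.refl _
  | _, _, .comp f g => (posPre f).trans (posPre g)
  | _, _, .tensor f g => Equiv.sumCongr (posPre f) (posPre g)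
  | _, _, .assoc _ _ _ => Equiv.sumAssoc _ _ _
  | _, _, .assocInv _ _ _ => (Equiv.sumAssoc _ _ _).symm
  | _, _, .left X => Equiv.emptySum Empty (Pos X)
  | _, _, .leftInv X => (Equiv.emptySum Empty (Pos X)).symm
  | _, _, .right X => Equiv.sumEmpty (Pos X) Empty
  | _, _, .rightInv X => (Equiv.sumEmpty (Pos X) Empty).symm
  | _, _, .symm _ _ => Equiv.sumComm _ _

theorem posPre_sound {X Y : FreeSMC T} {f g : Pre X Y} (h : Rel f g) :
    posPre f = posPre g := by
  induction h with
  | refl f => rfl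
  | symm _ ih => exact ih.symm
  | trans _ _ ih₁ ih₂ => exact ih₁.trans ih₂
  | comp _ _ ih₁ ih₂ => simp only [posPre, ih₁, ih₂]
  | tensor _ _ ih₁ ih₂ => exact congrArg₂ Equiv.sumCongr ih₁ ih₂
  | assoc_naturality => exact Equiv.ext (by rintro ((x | x) | x) <;> rfl)
  | pentagon => exact Equiv.ext (by rintro (((x | x) | x) | x) <;> rfl)
  | hexagon => exact Equiv.ext (by rintro ((x | x) | x) <;> rfl)
  | triangle => exact Equiv.ext (by rintro ((x | x) | x) <;> first | rfl | cases x)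
  | left_naturality => exact Equiv.ext (by rintro (x | x) <;> first | rfl | cases x)
  | right_naturality => exact Equiv.ext (by rintro (x | x) <;> first | rfl | cases x)
  | symm_unit => exact Equiv.ext (by rintro (x | x) <;> rfl)
  | symm_naturality => exact Equiv.ext (by rintro (x | x) <;> rfl)
  | tensor_comp => exact Equiv.ext (by rintro (x | x) <;> rfl)
  | tensor_id => exact Equiv.ext (by rintro (x | x) <;> rfl)
  | symm_symm => exact Equiv.ext (by rintro (x | x) <;> rfl)
  | id_comp f => rfl
  | comp_id f => rfl
  | comp_assoc f g h => rfl
  | _ => simp [posPre, Pos]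

/-- The motion of positions along a morphism. -/
def posMap {X Y : FreeSMC T} (f : X ⟶ Y) : Pos X ≃ Pos Y :=
  Quotient.lift posPre (fun _ _ h => posPre_sound h) f

end perm

end FreeSMC

/-! ### The free strong symmetric monoidal functor on a set -/

/-- Objects of the target of the free strong symmetric monoidal functor `𝓕` on `T`: parenthesized
words in formal units and terms `𝓕(W)`, with `W` an object of the free symmetric monoidal
category on `T`. -/
inductive FreeStrong (T : Type*) : Type _
  | app : FreeSMC T → FreeStrong T
  | unit : FreeStrong T
  | tensor : FreeStrong T → FreeStrong T → FreeStrong T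

namespace FreeStrong

/-- Formal composites of expanded instances of: the morphisms `𝓕(f)` for `f` in the free symmetric
monoidal category; associators, unitors and symmetries; the structure maps
`i : I ⟶ 𝓕(I)` and `m : 𝓕(W) ⊗ 𝓕(W') ⟶ 𝓕(W ⊗ W')` and their inverses. -/
inductive Pre {T : Type*} : FreeStrong T → FreeStrong T → Type _
  | id (X : FreeStrong T) : Pre X X
  | comp {X Y Z : FreeStrong T} (f : Pre X Y) (g : Pre Y Z) : Pre X Z
  | tensor {X Y X' Y' : FreeStrong T} (f : Pre X Y) (g : Pre X' Y') :
      Pre (X.tensor X') (Y.tensor Y')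
  | assoc (X Y Z : FreeStrong T) : Pre ((X.tensor Y).tensor Z) (X.tensor (Y.tensor Z))
  | assocInv (X Y Z : FreeStrong T) : Pre (X.tensor (Y.tensor Z)) ((X.tensor Y).tensor Z)
  | left (X : FreeStrong T) : Pre (unit.tensor X) X
  | leftInv (X : FreeStrong T) : Pre X (unit.tensor X)
  | right (X : FreeStrong T) : Pre (X.tensor unit) X
  | rightInv (X : FreeStrong T) : Pre X (X.tensor unit)
  | symm (X Y : FreeStrong T) : Pre (X.tensor Y) (Y.tensor X)
  | map {V W : FreeSMC T} (f : V ⟶ W) : Pre (app V) (app W)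
  | i : Pre unit (app (𝟙_ (FreeSMC T)))
  | iInv : Pre (app (𝟙_ (FreeSMC T))) unit
  | m (V W : FreeSMC T) : Pre ((app V).tensor (app W)) (app (V ⊗ W))
  | mInv (V W : FreeSMC T) : Pre (app (V ⊗ W)) ((app V).tensor (app W))

/-- The congruence generated by the axioms of a symmetric monoidal category and those of a
strong symmetric monoidal functor. -/
inductive Rel {T : Type*} : ∀ {X Y : FreeStrong T}, Pre X Y → Pre X Y → Prop
  | refl {X Y : FreeStrong T} (f : Pre X Y) : Rel f f
  | symm {X Y : FreeStrong T} {f g : Pre X Y} : Rel f g → Rel g f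
  | trans {X Y : FreeStrong T} {f g h : Pre X Y} : Rel f g → Rel g h → Rel f h
  | comp {X Y Z : FreeStrong T} {f f' : Pre X Y} {g g' : Pre Y Z} :
      Rel f f' → Rel g g' → Rel (f.comp g) (f'.comp g')
  | tensor {X Y X' Y' : FreeStrong T} {f f' : Pre X Y} {g g' : Pre X' Y'} :
      Rel f f' → Rel g g' → Rel (f.tensor g) (f'.tensor g')
  | id_comp {X Y : FreeStrong T} (f : Pre X Y) : Rel ((Pre.id X).comp f) f
  | comp_id {X Y : FreeStrong T} (f : Pre X Y) : Rel (f.comp (Pre.id Y)) f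
  | comp_assoc {W X Y Z : FreeStrong T} (f : Pre W X) (g : Pre X Y) (h : Pre Y Z) :
      Rel ((f.comp g).comp h) (f.comp (g.comp h))
  | tensor_id (X Y : FreeStrong T) : Rel ((Pre.id X).tensor (Pre.id Y)) (Pre.id (X.tensor Y))
  | tensor_comp {X Y Z X' Y' Z' : FreeStrong T} (f : Pre X Y) (f' : Pre X' Y')
      (g : Pre Y Z) (g' : Pre Y' Z') :
      Rel ((f.tensor f').comp (g.tensor g')) ((f.comp g).tensor (f'.comp g'))
  | assoc_assocInv (X Y Z : FreeStrong T) :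
      Rel ((Pre.assoc X Y Z).comp (Pre.assocInv X Y Z)) (Pre.id _)
  | assocInv_assoc (X Y Z : FreeStrong T) :
      Rel ((Pre.assocInv X Y Z).comp (Pre.assoc X Y Z)) (Pre.id _)
  | left_leftInv (X : FreeStrong T) : Rel ((Pre.left X).comp (Pre.leftInv X)) (Pre.id _)
  | leftInv_left (X : FreeStrong T) : Rel ((Pre.leftInv X).comp (Pre.left X)) (Pre.id _)
  | right_rightInv (X : FreeStrong T) : Rel ((Pre.right X).comp (Pre.rightInv X)) (Pre.id _)
  | rightInv_right (X : FreeStrong T) : Rel ((Pre.rightInv X).comp (Pre.right X)) (Pre.id _)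
  | symm_symm (X Y : FreeStrong T) : Rel ((Pre.symm X Y).comp (Pre.symm Y X)) (Pre.id _)
  | assoc_naturality {X₁ X₂ X₃ Y₁ Y₂ Y₃ : FreeStrong T}
      (f₁ : Pre X₁ Y₁) (f₂ : Pre X₂ Y₂) (f₃ : Pre X₃ Y₃) :
      Rel (((f₁.tensor f₂).tensor f₃).comp (Pre.assoc Y₁ Y₂ Y₃))
        ((Pre.assoc X₁ X₂ X₃).comp (f₁.tensor (f₂.tensor f₃)))
  | left_naturality {X Y : FreeStrong T} (f : Pre X Y) :
      Rel (((Pre.id unit).tensor f).comp (Pre.left Y)) ((Pre.left X).comp f)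
  | right_naturality {X Y : FreeStrong T} (f : Pre X Y) :
      Rel ((f.tensor (Pre.id unit)).comp (Pre.right Y)) ((Pre.right X).comp f)
  | symm_naturality {X Y X' Y' : FreeStrong T} (f : Pre X Y) (g : Pre X' Y') :
      Rel ((f.tensor g).comp (Pre.symm Y Y')) ((Pre.symm X X').comp (g.tensor f))
  | pentagon (W X Y Z : FreeStrong T) :
      Rel (((Pre.assoc W X Y).tensor (Pre.id Z)).comp
          ((Pre.assoc W (X.tensor Y) Z).comp ((Pre.id W).tensor (Pre.assoc X Y Z))))
        ((Pre.assoc (W.tensor X) Y Z).comp (Pre.assoc W X (Y.tensor Z)))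
  | triangle (X Y : FreeStrong T) :
      Rel ((Pre.assoc X unit Y).comp ((Pre.id X).tensor (Pre.left Y)))
        ((Pre.right X).tensor (Pre.id Y))
  | symm_unit (X : FreeStrong T) :
      Rel ((Pre.symm X unit).comp (Pre.left X)) (Pre.right X)
  | hexagon (X Y Z : FreeStrong T) :
      Rel ((Pre.assoc X Y Z).comp ((Pre.symm X (Y.tensor Z)).comp (Pre.assoc Y Z X)))
        (((Pre.symm X Y).tensor (Pre.id Z)).comp
          ((Pre.assoc Y X Z).comp ((Pre.id Y).tensor (Pre.symm X Z))))
  | map_id (W : FreeSMC T) : Rel (Pre.map (𝟙 W)) (Pre.id (app W))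
  | map_comp {U V W : FreeSMC T} (f : U ⟶ V) (g : V ⟶ W) :
      Rel (Pre.map (f ≫ g)) ((Pre.map f).comp (Pre.map g))
  | i_iInv : Rel (Pre.i.comp Pre.iInv) (Pre.id _)
  | iInv_i : Rel (Pre.iInv.comp Pre.i) (Pre.id _)
  | m_mInv (V W : FreeSMC T) : Rel ((Pre.m V W).comp (Pre.mInv V W)) (Pre.id _)
  | mInv_m (V W : FreeSMC T) : Rel ((Pre.mInv V W).comp (Pre.m V W)) (Pre.id _)
  | m_naturality {V W V' W' : FreeSMC T} (f : V ⟶ W) (g : V' ⟶ W') :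
      Rel (((Pre.map f).tensor (Pre.map g)).comp (Pre.m W W'))
        ((Pre.m V V').comp (Pre.map (f ⊗ₘ g)))
  | m_assoc (U V W : FreeSMC T) :
      Rel (((Pre.m U V).tensor (Pre.id (app W))).comp
          ((Pre.m (U ⊗ V) W).comp (Pre.map (α_ U V W).hom)))
        ((Pre.assoc (app U) (app V) (app W)).comp
          (((Pre.id (app U)).tensor (Pre.m V W)).comp (Pre.m U (V ⊗ W))))
  | left_unitality (W : FreeSMC T) :
      Rel (Pre.left (app W))
        ((Pre.i.tensor (Pre.id (app W))).comp
          ((Pre.m (𝟙_ (FreeSMC T)) W).comp (Pre.map (λ_ W).hom)))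
  | right_unitality (W : FreeSMC T) :
      Rel (Pre.right (app W))
        (((Pre.id (app W)).tensor Pre.i).comp
          ((Pre.m W (𝟙_ (FreeSMC T))).comp (Pre.map (ρ_ W).hom)))
  | m_symm (V W : FreeSMC T) :
      Rel ((Pre.m V W).comp (Pre.map (β_ V W).hom))
        ((Pre.symm (app V) (app W)).comp (Pre.m W V))

instance homSetoid {T : Type*} (X Y : FreeStrong T) : Setoid (Pre X Y) :=
  ⟨Rel, ⟨Rel.refl, Rel.symm, Rel.trans⟩⟩

/-- The morphisms are the *formal morphisms*. -/
instance category {T : Type*} : Category (FreeStrong T) where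
  Hom X Y := Quotient (homSetoid X Y)
  id X := ⟦Pre.id X⟧
  comp := Quotient.map₂ Pre.comp (fun _ _ hf _ _ hg => Rel.comp hf hg)
  id_comp := by rintro X Y ⟨f⟩; exact Quotient.sound (Rel.id_comp f)
  comp_id := by rintro X Y ⟨f⟩; exact Quotient.sound (Rel.comp_id f)
  assoc := by rintro W X Y Z ⟨f⟩ ⟨g⟩ ⟨h⟩; exact Quotient.sound (Rel.comp_assoc f g h)

/-- The tensor product of morphisms. -/
def tensorMap {T : Type*} {X Y X' Y' : FreeStrong T} (f : X ⟶ Y) (g : X' ⟶ Y') :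
    X.tensor X' ⟶ Y.tensor Y' :=
  Quotient.map₂ Pre.tensor (fun _ _ hf _ _ hg => Rel.tensor hf hg) f g

instance monoidalStruct {T : Type*} : MonoidalCategoryStruct (FreeStrong T) where
  tensorObj := tensor
  whiskerLeft X _ _ f := tensorMap (𝟙 X) f
  whiskerRight f Y := tensorMap f (𝟙 Y)
  tensorHom f g := tensorMap f g
  tensorUnit := unit
  associator X Y Z := ⟨⟦Pre.assoc X Y Z⟧, ⟦Pre.assocInv X Y Z⟧,
    Quotient.sound (Rel.assoc_assocInv X Y Z), Quotient.sound (Rel.assocInv_assoc X Y Z)⟩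
  leftUnitor X := ⟨⟦Pre.left X⟧, ⟦Pre.leftInv X⟧,
    Quotient.sound (Rel.left_leftInv X), Quotient.sound (Rel.leftInv_left X)⟩
  rightUnitor X := ⟨⟦Pre.right X⟧, ⟦Pre.rightInv X⟧,
    Quotient.sound (Rel.right_rightInv X), Quotient.sound (Rel.rightInv_right X)⟩

instance monoidal {T : Type*} : MonoidalCategory (FreeStrong T) :=
  MonoidalCategory.ofTensorHom
    (id_tensorHom_id := fun X Y => Quotient.sound (Rel.tensor_id X Y))
    (id_tensorHom := fun _ _ _ _ => rfl)
    (tensorHom_id := fun _ _ => rfl)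
    (tensorHom_comp_tensorHom := by
      rintro _ _ _ _ _ _ ⟨f⟩ ⟨f'⟩ ⟨g⟩ ⟨g'⟩
      exact Quotient.sound (Rel.tensor_comp f f' g g'))
    (associator_naturality := by
      rintro _ _ _ _ _ _ ⟨f⟩ ⟨g⟩ ⟨h⟩
      exact Quotient.sound (Rel.assoc_naturality f g h))
    (leftUnitor_naturality := by
      rintro _ _ ⟨f⟩
      exact Quotient.sound (Rel.left_naturality f))
    (rightUnitor_naturality := by
      rintro _ _ ⟨f⟩
      exact Quotient.sound (Rel.right_naturality f))
    (pentagon := fun W X Y Z => Quotient.sound (Rel.pentagon W X Y Z))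
    (triangle := fun X Y => Quotient.sound (Rel.triangle X Y))

/-- The symmetry isomorphism. -/
def symmIso {T : Type*} (X Y : FreeStrong T) : X ⊗ Y ≅ Y ⊗ X :=
  ⟨⟦Pre.symm X Y⟧, ⟦Pre.symm Y X⟧,
    Quotient.sound (Rel.symm_symm X Y), Quotient.sound (Rel.symm_symm Y X)⟩

theorem symmIso_hexagon {T : Type*} (X Y Z : FreeStrong T) :
    (α_ X Y Z).hom ≫ (symmIso X (Y ⊗ Z)).hom ≫ (α_ Y Z X).hom =
      (symmIso X Y).hom ▷ Z ≫ (α_ Y X Z).hom ≫ Y ◁ (symmIso X Z).hom :=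
  Quotient.sound (Rel.hexagon X Y Z)

instance symmetric {T : Type*} : SymmetricCategory (FreeStrong T) where
  braiding := symmIso
  braiding_naturality_right X Y Z f := by
    induction f using Quotient.inductionOn with
    | _ f => exact Quotient.sound (Rel.symm_naturality (Pre.id X) f)
  braiding_naturality_left f Z := by
    induction f using Quotient.inductionOn with
    | _ f => exact Quotient.sound (Rel.symm_naturality f (Pre.id Z))
  hexagon_forward := symmIso_hexagon
  hexagon_reverse X Y Z := by
    have h := symmIso_hexagon Z X Y
    have e : ∀ A B : FreeStrong T, (symmIso A B).inv = (symmIso B A).hom := fun _ _ => rfl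
    have h' : ((α_ Z X Y) ≪≫ symmIso Z (X ⊗ Y) ≪≫ (α_ X Y Z)).inv =
        (whiskerRightIso (symmIso Z X) Y ≪≫ (α_ X Z Y) ≪≫ whiskerLeftIso X (symmIso Z Y)).inv := by
      congr 1
      ext
      exact h
    simpa [e] using h'
  symmetry X Y := (symmIso X Y).hom_inv_id

/-- The free strong symmetric monoidal functor `𝓕` on `T`. -/
def functor (T : Type*) : FreeSMC T ⥤ FreeStrong T where
  obj := app
  map f := ⟦Pre.map f⟧
  map_id W := Quotient.sound (Rel.map_id W)
  map_comp f g := Quotient.sound (Rel.map_comp f g)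

/-- Its structure maps are `i` and `m`. -/
def functorCoreMonoidal (T : Type*) : (functor T).CoreMonoidal where
  εIso := ⟨⟦Pre.i⟧, ⟦Pre.iInv⟧, Quotient.sound Rel.i_iInv, Quotient.sound Rel.iInv_i⟩
  μIso V W := ⟨⟦Pre.m V W⟧, ⟦Pre.mInv V W⟧,
    Quotient.sound (Rel.m_mInv V W), Quotient.sound (Rel.mInv_m V W)⟩
  μIso_hom_natural_left f W := by
    rw [← tensorHom_id, ← tensorHom_id, ← (functor T).map_id W]
    exact Quotient.sound (Rel.m_naturality f (𝟙 W))
  μIso_hom_natural_right W f := by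
    rw [← id_tensorHom, ← id_tensorHom, ← (functor T).map_id W]
    exact Quotient.sound (Rel.m_naturality (𝟙 W) f)
  associativity U V W := Quotient.sound (Rel.m_assoc U V W)
  left_unitality W := Quotient.sound (Rel.left_unitality W)
  right_unitality W := Quotient.sound (Rel.right_unitality W)

instance functorBraided (T : Type*) : (functor T).Braided where
  toMonoidal := (functorCoreMonoidal T).toMonoidal
  braided V W := Quotient.sound (Rel.m_symm V W)

section lift

variable {T : Type*} {C : Type*} [Category C] [MonoidalCategory C] [SymmetricCategory C]
  {D : Type*} [Category D] [MonoidalCategory D] [SymmetricCategory D]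
  (F : C ⥤ D) [F.Braided] (φ : T → C)

open Functor.LaxMonoidal Functor.OplaxMonoidal

/-- The value in `D` of a formal word. -/
def liftObj : FreeStrong T → D
  | app W => F.obj ((FreeSMC.lift φ).obj W)
  | unit => 𝟙_ D
  | tensor X Y => liftObj X ⊗ liftObj Y

/-- The value in `D` of a formal composite. -/
def liftPre : ∀ {X Y : FreeStrong T}, Pre X Y → (liftObj F φ X ⟶ liftObj F φ Y)
  | _, _, .id _ => 𝟙 _
  | _, _, .comp f g => liftPre f ≫ liftPre g
  | _, _, .tensor f g => liftPre f ⊗ₘ liftPre g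
  | _, _, .assoc _ _ _ => (α_ _ _ _).hom
  | _, _, .assocInv _ _ _ => (α_ _ _ _).inv
  | _, _, .left _ => (λ_ _).hom
  | _, _, .leftInv _ => (λ_ _).inv
  | _, _, .right _ => (ρ_ _).hom
  | _, _, .rightInv _ => (ρ_ _).inv
  | _, _, .symm _ _ => (β_ _ _).hom
  | _, _, .map f => F.map ((FreeSMC.lift φ).map f)
  | _, _, .i => ε F
  | _, _, .iInv => η F
  | _, _, .m V W => μ F ((FreeSMC.lift φ).obj V) ((FreeSMC.lift φ).obj W)
  | _, _, .mInv V W => δ F ((FreeSMC.lift φ).obj V) ((FreeSMC.lift φ).obj W)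

theorem liftPre_sound {X Y : FreeStrong T} {f g : Pre X Y} (h : Rel f g) :
    liftPre F φ f = liftPre F φ g := by
  induction h with
  | refl f => rfl
  | symm _ ih => exact ih.symm
  | trans _ _ ih₁ ih₂ => exact ih₁.trans ih₂
  | comp _ _ ih₁ ih₂ => simp only [liftPre, ih₁, ih₂]
  | tensor _ _ ih₁ ih₂ => exact congrArg₂ (fun a b => a ⊗ₘ b) ih₁ ih₂
  | i_iInv => exact Functor.Monoidal.ε_η F
  | iInv_i => exact Functor.Monoidal.η_ε F
  | m_mInv V W => exact Functor.Monoidal.μ_δ F _ _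
  | mInv_m V W => exact Functor.Monoidal.δ_μ F _ _
  | m_naturality f g =>
    induction f using Quotient.inductionOn
    induction g using Quotient.inductionOn
    exact μ_natural F _ _
  | m_assoc U V W =>
    have h := Functor.LaxMonoidal.associativity F (FreeSMC.liftObj φ U) (FreeSMC.liftObj φ V)
      (FreeSMC.liftObj φ W)
    rw [← tensorHom_id, ← id_tensorHom] at h
    exact h
  | left_unitality W =>
    have h := Functor.LaxMonoidal.left_unitality F (FreeSMC.liftObj φ W)
    rw [← tensorHom_id] at h
    exact h
  | right_unitality W =>
    have h := Functor.LaxMonoidal.right_unitality F (FreeSMC.liftObj φ W)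
    rw [← id_tensorHom] at h
    exact h
  | m_symm V W => exact Functor.LaxBraided.braided _ _
  | _ => simp [liftPre, liftObj]

/-- The strict symmetric monoidal functor out of the target of the free strong symmetric monoidal
functor on `T` that is determined by `F` and `φ : T → C`. -/
def lift : FreeStrong T ⥤ D where
  obj := liftObj F φ
  map f := Quotient.lift (liftPre F φ) (fun _ _ h => liftPre_sound F φ h) f
  map_id _ := rfl
  map_comp := by rintro _ _ _ ⟨f⟩ ⟨g⟩; rfl

/-- The square formed by `𝓕`, `F` and the two strict functors commutes strictly. -/
theorem functor_comp_lift : functor T ⋙ lift F φ = FreeSMC.lift φ ⋙ F := rfl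

end lift

section perm

variable {T : Type*}

/-- The set of positions in a word occupied by elements of `T` (formal units are ignored). -/
def Pos : FreeStrong T → Type
  | app W => FreeSMC.Pos W
  | unit => Empty
  | tensor X Y => Pos X ⊕ Pos Y

/-- The element of `T` at a given position. -/
def letterAt : ∀ X : FreeStrong T, Pos X → T
  | app W, p => FreeSMC.letterAt W p
  | unit, p => nomatch p
  | tensor X Y, p => Sum.elim (letterAt X) (letterAt Y) p

/-- The number `n` of elements of `T` in a word. -/
def len : FreeStrong T → ℕ
  | app W => W.len
  | unit => 0
  | tensor X Y => len X + len Y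

/-- The positions are numbered from left to right. -/
def posEquiv : ∀ X : FreeStrong T, Pos X ≃ Fin (len X)
  | app W => W.posEquiv
  | unit => Equiv.equivOfIsEmpty Empty (Fin 0)
  | tensor X Y => (Equiv.sumCongr (posEquiv X) (posEquiv Y)).trans finSumFinEquiv

/-- The list `X₁, …, Xₙ` of elements of `T` in a word, from left to right. -/
def letters (X : FreeStrong T) (k : Fin X.len) : T :=
  letterAt X (X.posEquiv.symm k)

/-- The motion of positions along a formal composite. -/
def posPre : ∀ {X Y : FreeStrong T}, Pre X Y → (Pos X ≃ Pos Y)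
  | _, _, .id _ => Equiv.refl _
  | _, _, .comp f g => (posPre f).trans (posPre g)
  | _, _, .tensor f g => Equiv.sumCongr (posPre f) (posPre g)
  | _, _, .assoc _ _ _ => Equiv.sumAssoc _ _ _
  | _, _, .assocInv _ _ _ => (Equiv.sumAssoc _ _ _).symm
  | _, _, .left X => Equiv.emptySum Empty (Pos X)
  | _, _, .leftInv X => (Equiv.emptySum Empty (Pos X)).symm
  | _, _, .right X => Equiv.sumEmpty (Pos X) Empty
  | _, _, .rightInv X => (Equiv.sumEmpty (Pos X) Empty).symm
  | _, _, .symm _ _ => Equiv.sumComm _ _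
  | _, _, .map f => FreeSMC.posMap f
  | _, _, .i => Equiv.refl Empty
  | _, _, .iInv => Equiv.refl Empty
  | _, _, .m V W => Equiv.refl (FreeSMC.Pos V ⊕ FreeSMC.Pos W)
  | _, _, .mInv V W => Equiv.refl (FreeSMC.Pos V ⊕ FreeSMC.Pos W)

theorem posPre_sound {X Y : FreeStrong T} {f g : Pre X Y} (h : Rel f g) :
    posPre f = posPre g := by
  induction h with
  | refl f => rfl
  | symm _ ih => exact ih.symm
  | trans _ _ ih₁ ih₂ => exact ih₁.trans ih₂
  | comp _ _ ih₁ ih₂ => simp only [posPre, ih₁, ih₂]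
  | tensor _ _ ih₁ ih₂ => exact congrArg₂ Equiv.sumCongr ih₁ ih₂
  | assoc_naturality => exact Equiv.ext (by rintro ((x | x) | x) <;> rfl)
  | pentagon => exact Equiv.ext (by rintro (((x | x) | x) | x) <;> rfl)
  | hexagon => exact Equiv.ext (by rintro ((x | x) | x) <;> rfl)
  | triangle => exact Equiv.ext (by rintro ((x | x) | x) <;> first | rfl | cases x)
  | left_naturality => exact Equiv.ext (by rintro (x | x) <;> first | rfl | cases x)
  | right_naturality => exact Equiv.ext (by rintro (x | x) <;> first | rfl | cases x)
  | symm_unit => exact Equiv.ext (by rintro (x | x) <;> rfl)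
  | symm_naturality => exact Equiv.ext (by rintro (x | x) <;> rfl)
  | tensor_comp => exact Equiv.ext (by rintro (x | x) <;> rfl)
  | tensor_id => exact Equiv.ext (by rintro (x | x) <;> rfl)
  | symm_symm => exact Equiv.ext (by rintro (x | x) <;> rfl)
  | id_comp f => rfl
  | comp_id f => rfl
  | comp_assoc f g h => rfl
  | map_id W => rfl
  | map_comp f g =>
    induction f using Quotient.inductionOn
    induction g using Quotient.inductionOn
    rfl
  | i_iInv => rfl
  | iInv_i => rfl
  | m_mInv V W => rfl
  | mInv_m V W => rfl
  | m_naturality f g =>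
    induction f using Quotient.inductionOn
    induction g using Quotient.inductionOn
    exact Equiv.ext (by rintro (x | x) <;> rfl)
  | m_assoc U V W => exact Equiv.ext (by rintro ((x | x) | x) <;> rfl)
  | left_unitality W => exact Equiv.ext (by rintro (x | x) <;> rfl)
  | right_unitality W => exact Equiv.ext (by rintro (x | x) <;> rfl)
  | m_symm V W => exact Equiv.ext (by rintro (x | x) <;> rfl)
  | _ => simp [posPre, Pos]

/-- The motion of positions along a formal morphism. -/
def posMap {X Y : FreeStrong T} (f : X ⟶ Y) : Pos X ≃ Pos Y :=
  Quotient.lift posPre (fun _ _ h => posPre_sound h) f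

/-- The underlying permutation of a formal morphism `X ⟶ Y` between words with `n` letters: the
letter in place `k` of `X` is moved to place `perm f k` of `Y`. (The existence of the bijection
forces the two words to have the same number of letters.) -/
def perm {X Y : FreeStrong T} (f : X ⟶ Y) : Fin X.len ≃ Fin Y.len :=
  (X.posEquiv.symm.trans (posMap f)).trans Y.posEquiv

theorem perm_id (X : FreeStrong T) : perm (𝟙 X) = Equiv.refl _ := by
  ext k
  simp [perm, show posMap (𝟙 X) = Equiv.refl _ from rfl]

theorem perm_comp {X Y Z : FreeStrong T} (f : X ⟶ Y) (g : Y ⟶ Z) :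
    perm (f ≫ g) = (perm f).trans (perm g) := by
  have h : posMap (f ≫ g) = (posMap f).trans (posMap g) := by
    induction f using Quotient.inductionOn
    induction g using Quotient.inductionOn
    rfl
  ext k
  simp [perm, h]

end perm

end FreeStrong

/-! ### Formal diagrams of a strong symmetric monoidal functor -/

/-- The functor to `D` from the target of the free strong symmetric monoidal functor on the set of
objects of `C`, for a strong symmetric monoidal functor `F : C ⥤ D`. -/
def formalEval {C : Type*} [Category C] [MonoidalCategory C] [SymmetricCategory C]
    {D : Type*} [Category D] [MonoidalCategory D] [SymmetricCategory D]
    (F : C ⥤ D) [F.Braided] : FreeStrong C ⥤ D :=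
  FreeStrong.lift F id

/-- A diagram of shape `J` commutes if any two composites along parallel paths are equal. -/
def DiagramCommutes {J : Type*} [Quiver J] {D : Type*} [Category D] (G : J ⥤q D) : Prop :=
  ∀ ⦃a b : J⦄ (p q : Quiver.Path a b),
    composePath (G.mapPath p) = composePath (G.mapPath q)

/-- A formal diagram of `F` of shape `J`: a diagram in `D` together with a lift along
`formalEval F`. -/
structure FormalDiagram {C : Type*} [Category C] [MonoidalCategory C] [SymmetricCategory C]
    {D : Type*} [Category D] [MonoidalCategory D] [SymmetricCategory D]
    (F : C ⥤ D) [F.Braided] (J : Type*) [Quiver J] where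
  diagram : J ⥤q D
  lift : J ⥤q FreeStrong C
  fac : lift ⋙q (formalEval F).toPrefunctor = diagram

namespace FormalDiagram

variable {C : Type*} [Category C] [MonoidalCategory C] [SymmetricCategory C]
  {D : Type*} [Category D] [MonoidalCategory D] [SymmetricCategory D]
  {F : C ⥤ D} [F.Braided] {J : Type*} [Quiver J]

/-- The composites along any two parallel paths have the same underlying permutation. -/
def ExpectedToCommute (G : FormalDiagram F J) : Prop :=
  ∀ ⦃a b : J⦄ (p q : Quiver.Path a b),
    FreeStrong.perm (composePath (G.lift.mapPath p)) =
      FreeStrong.perm (composePath (G.lift.mapPath q))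

/-- In each word of the diagram the objects `X₁, …, Xₙ` are distinct. -/
def DistinctObjects (G : FormalDiagram F J) : Prop :=
  ∀ a : J, Function.Injective (G.lift.obj a).letters

end FormalDiagram

/-! Two reductions prove the second claim. Erasing every `𝓕` sends a word X of the free strong
functor to a word `collapse X` of Fr(T), and ε and μ of `F` assemble to an isomorphism ev(X) ≅
F(value of `collapse X`). Under these isomorphisms every formal morphism f becomes F applied to some
morphism k of Fr(T) that moves the letters as f does (`exists_collapses`): each axiom of a strong
symmetric monoidal functor settles one generator. Hence ev(f) is determined by k, and it remains to
see that k is determined by its permutation.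

That is coherence for symmetric monoidal categories (`hom_ext_of_posMap_eq`), proved by induction on
the number of letters. Select an occurrence of a letter t in X and let X' have a unit in its place;
then X ≅ t ⊗ X'. Every f : X ⟶ Y carries the occurrence to one in Y and, read through these
isomorphisms, is t ◁ f' for some f' : X' ⟶ Y' (`Occ.exists_compat`). If f and g have the same
permutation, they hit the same occurrence, f' and g' are parallel with the same permutation, and the
induction applies. Without letters, the canonical isomorphisms to the unit are natural, so parallel
morphisms agree.

The claim on diagrams follows by functoriality of ev. If letters are distinct, the permutation is
forced, since formal morphisms preserve letters. -/

/-! ### Moving one object to the front of a tensor product. -/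

section

variable {C : Type*} [Category C] [MonoidalCategory C] [SymmetricCategory C]

/-- Moving the object `t` to the front of `X ⊗ (t ⊗ Y)`. -/
def CategoryTheory.MonoidalCategory.moveFront (X t Y : C) : X ⊗ (t ⊗ Y) ≅ t ⊗ (X ⊗ Y) :=
  (α_ X t Y).symm ≪≫ whiskerRightIso (β_ X t) Y ≪≫ α_ t X Y

namespace CategoryTheory.MonoidalCategory

/-- Both factors are natural, as β and α are; this is what lets a selected letter pass a morphism
acting on the factor to its left. -/
theorem moveFront_naturality {X X' Y Y' : C} (t : C) (f : X ⟶ X') (g : Y ⟶ Y') :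
    (f ⊗ₘ (t ◁ g)) ≫ (moveFront X' t Y').hom = (moveFront X t Y).hom ≫ t ◁ (f ⊗ₘ g) := by
  simp only [moveFront, Iso.trans_hom, Iso.symm_hom, whiskerRightIso_hom,
    MonoidalCategory.tensorHom_def, Category.assoc, whiskerLeft_comp]
  rw [associator_inv_naturality_right_assoc, associator_inv_naturality_left_assoc,
    whisker_exchange_assoc, ← comp_whiskerRight_assoc, BraidedCategory.braiding_naturality_left]
  simp

end CategoryTheory.MonoidalCategory

end

/-! ### Structure maps against maps to the unit, and against moving to the front. -/

section

variable {C : Type*} [Category C] [MonoidalCategory C]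

namespace CategoryTheory.MonoidalCategory

/-- Naturality of α removes a, b, c and leaves the two ways of multiplying three units. This and the
next three lemmas are the generator cases for words without letters. -/
theorem associator_hom_comp_unit {X Y Z : C} (a : X ⟶ 𝟙_ C) (b : Y ⟶ 𝟙_ C) (c : Z ⟶ 𝟙_ C) :
    (α_ X Y Z).hom ≫ (a ⊗ₘ ((b ⊗ₘ c) ≫ (λ_ (𝟙_ C)).hom)) ≫ (λ_ (𝟙_ C)).hom =
      (((a ⊗ₘ b) ≫ (λ_ (𝟙_ C)).hom) ⊗ₘ c) ≫ (λ_ (𝟙_ C)).hom := by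
  have h : (a ⊗ₘ ((b ⊗ₘ c) ≫ (λ_ (𝟙_ C)).hom)) = (a ⊗ₘ (b ⊗ₘ c)) ≫ 𝟙_ C ◁ (λ_ (𝟙_ C)).hom := by
    rw [← id_tensorHom, tensorHom_comp_tensorHom, Category.comp_id]
  have h' : (((a ⊗ₘ b) ≫ (λ_ (𝟙_ C)).hom) ⊗ₘ c) = ((a ⊗ₘ b) ⊗ₘ c) ≫ (λ_ (𝟙_ C)).hom ▷ 𝟙_ C := by
    rw [← tensorHom_id, tensorHom_comp_tensorHom, Category.comp_id]
  rw [h, h', Category.assoc, Category.assoc, ← associator_naturality_assoc]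
  monoidal

theorem leftUnitor_hom_comp_unit {X : C} (a : X ⟶ 𝟙_ C) :
    (λ_ X).hom ≫ a = (𝟙 (𝟙_ C) ⊗ₘ a) ≫ (λ_ (𝟙_ C)).hom := by
  simp

theorem rightUnitor_hom_comp_unit {X : C} (a : X ⟶ 𝟙_ C) :
    (ρ_ X).hom ≫ a = (a ⊗ₘ 𝟙 (𝟙_ C)) ≫ (λ_ (𝟙_ C)).hom := by
  simp [unitors_equal]

theorem braiding_hom_comp_unit [SymmetricCategory C] {X Y : C} (a : X ⟶ 𝟙_ C) (b : Y ⟶ 𝟙_ C) :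
    (β_ X Y).hom ≫ (b ⊗ₘ a) ≫ (λ_ (𝟙_ C)).hom = (a ⊗ₘ b) ≫ (λ_ (𝟙_ C)).hom := by
  rw [← BraidedCategory.braiding_naturality_assoc, braiding_leftUnitor, unitors_equal]

/-- This and the next two lemmas treat t in the first, second and third factor: the pentagon,
monoidal coherence around a single braiding, and the hexagon splitting the braiding of X ⊗ Y with t.
-/
theorem associator_front_left (t X Y Z : C) :
    (α_ (t ⊗ X) Y Z).hom ≫ (α_ t X (Y ⊗ Z)).hom =
      (α_ t X Y).hom ▷ Z ≫ (α_ t (X ⊗ Y) Z).hom ≫ t ◁ (α_ X Y Z).hom :=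
  (pentagon t X Y Z).symm

variable [SymmetricCategory C]

theorem associator_front_middle (t X Y Z : C) :
    (α_ X (t ⊗ Y) Z).hom ≫ X ◁ (α_ t Y Z).hom ≫ (moveFront X t (Y ⊗ Z)).hom =
      (moveFront X t Y).hom ▷ Z ≫ (α_ t (X ⊗ Y) Z).hom ≫ t ◁ (α_ X Y Z).hom := by
  simp only [moveFront, Iso.trans_hom, Iso.symm_hom, whiskerRightIso_hom, comp_whiskerRight,
    Category.assoc]
  monoidal

theorem associator_front_right (t X Y Z : C) :
    (α_ X Y (t ⊗ Z)).hom ≫ X ◁ (moveFront Y t Z).hom ≫ (moveFront X t (Y ⊗ Z)).hom =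
      (moveFront (X ⊗ Y) t Z).hom ≫ t ◁ (α_ X Y Z).hom := by
  simp only [moveFront, Iso.trans_hom, Iso.symm_hom, whiskerRightIso_hom,
    Category.assoc, BraidedCategory.braiding_tensor_left_hom, whiskerLeft_comp, comp_whiskerRight]
  monoidal

/-- Symmetry, not merely a braiding, is needed: after the hexagon, the braiding of t past Y must
cancel against that of Y past t. -/
theorem braiding_front_left (t X Y : C) :
    (β_ (t ⊗ X) Y).hom ≫ (moveFront Y t X).hom = (α_ t X Y).hom ≫ t ◁ (β_ X Y).hom := by
  simp only [moveFront, Iso.trans_hom, Iso.symm_hom, whiskerRightIso_hom,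
    Category.assoc, BraidedCategory.braiding_tensor_left_hom]
  simp [← comp_whiskerRight_assoc]

theorem braiding_front_right (t X Y : C) :
    (β_ X (t ⊗ Y)).hom ≫ (α_ t Y X).hom = (moveFront X t Y).hom ≫ t ◁ (β_ X Y).hom := by
  simp only [moveFront, Iso.trans_hom, Iso.symm_hom, whiskerRightIso_hom,
    Category.assoc, BraidedCategory.braiding_tensor_right_hom]
  simp

theorem leftUnitor_front (t X : C) :
    (λ_ (t ⊗ X)).hom = (moveFront (𝟙_ C) t X).hom ≫ t ◁ (λ_ X).hom := by
  simp [moveFront, braiding_tensorUnit_left]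

end CategoryTheory.MonoidalCategory

end

/-! ### Coherence for symmetric monoidal categories: words without letters. -/

namespace FreeSMC

variable {T : Type*}

theorem posMap_comp {X Y Z : FreeSMC T} (f : X ⟶ Y) (g : Y ⟶ Z) :
    posMap (f ≫ g) = (posMap f).trans (posMap g) := by
  induction f using Quotient.inductionOn
  induction g using Quotient.inductionOn
  rfl

theorem posMap_inv_hom {X Y : FreeSMC T} (f : X ≅ Y) (p : Pos X) :
    posMap f.inv (posMap f.hom p) = p := by
  have h := posMap_comp f.hom f.inv
  rw [f.hom_inv_id] at h
  exact (Equiv.congr_fun h p).symm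

theorem posMap_tensorHom {X Y X' Y' : FreeSMC T} (f : X ⟶ Y) (g : X' ⟶ Y') :
    posMap (f ⊗ₘ g) = Equiv.sumCongr (posMap f) (posMap g) := by
  induction f using Quotient.inductionOn
  induction g using Quotient.inductionOn
  rfl

/-- A word without letters. -/
inductive NoLetter : FreeSMC T → Type _
  | unit : NoLetter unit
  | tensor {X Y : FreeSMC T} : NoLetter X → NoLetter Y → NoLetter (X.tensor Y)

/-- The witness is data so that an isomorphism can be defined by recursion on it; uniqueness makes
that isomorphism depend on the word alone. -/
instance (X : FreeSMC T) : Subsingleton (NoLetter X) where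
  allEq a b := by
    induction a with
    | unit => cases b; rfl
    | tensor _ _ h₁ h₂ =>
      cases b with
      | tensor b₁ b₂ => rw [h₁ b₁, h₂ b₂]

/-- A word without letters is isomorphic to the unit. -/
def NoLetter.iso : ∀ {X : FreeSMC T}, NoLetter X → (X ≅ 𝟙_ (FreeSMC T))
  | _, .unit => Iso.refl _
  | _, .tensor a b => (a.iso ⊗ᵢ b.iso) ≪≫ λ_ (𝟙_ (FreeSMC T))

/-- The witness for the target is produced along with the equation, because a composite passes
through an intermediate word not yet known to lack letters. -/
theorem NoLetter.exists_iso_naturality {X Y : FreeSMC T} (f : Pre X Y) (a : NoLetter X) :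
    ∃ b : NoLetter Y, (⟦f⟧ : X ⟶ Y) ≫ b.iso.hom = a.iso.hom := by
  induction f with
  | id X => exact ⟨a, Category.id_comp _⟩
  | comp f g hf hg =>
    obtain ⟨b, hb⟩ := hf a
    obtain ⟨c, hc⟩ := hg b
    refine ⟨c, ?_⟩
    rw [← hb, ← hc, ← Category.assoc]
    rfl
  | @tensor X Y X' Y' f g hf hg =>
    cases a with
    | tensor a₁ a₂ =>
      obtain ⟨b₁, h₁⟩ := hf a₁
      obtain ⟨b₂, h₂⟩ := hg a₂
      refine ⟨b₁.tensor b₂, ?_⟩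
      simp only [iso, Iso.trans_hom, tensorIso_hom, ← h₁, ← h₂]
      exact tensorHom_comp_tensorHom_assoc (show X ⟶ Y from ⟦f⟧) (show X' ⟶ Y' from ⟦g⟧) _ _ _
  | assoc X Y Z =>
    obtain _ | ⟨_ | ⟨a₁, a₂⟩, a₃⟩ := a
    exact ⟨a₁.tensor (a₂.tensor a₃), associator_hom_comp_unit _ _ _⟩
  | assocInv X Y Z =>
    obtain _ | ⟨a₁, _ | ⟨a₂, a₃⟩⟩ := a
    exact ⟨(a₁.tensor a₂).tensor a₃,
      (Iso.inv_comp_eq (α_ X Y Z)).mpr (associator_hom_comp_unit _ _ _).symm⟩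
  | left X =>
    obtain _ | ⟨⟨⟩, a⟩ := a
    exact ⟨a, leftUnitor_hom_comp_unit _⟩
  | leftInv X =>
    exact ⟨NoLetter.unit.tensor a, (Iso.inv_comp_eq (λ_ X)).mpr (leftUnitor_hom_comp_unit _).symm⟩
  | right X =>
    obtain _ | ⟨a, ⟨⟩⟩ := a
    exact ⟨a, rightUnitor_hom_comp_unit _⟩
  | rightInv X =>
    exact ⟨a.tensor .unit, (Iso.inv_comp_eq (ρ_ X)).mpr (rightUnitor_hom_comp_unit _).symm⟩
  | symm X Y =>
    obtain _ | ⟨a, b⟩ := a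
    exact ⟨b.tensor a, braiding_hom_comp_unit _ _⟩

/-- An occurrence of the letter `t` in a word `X`; the word `X'` arises from `X` by
replacing it by the formal unit. -/
inductive Occ (t : T) : FreeSMC T → FreeSMC T → Type _
  | of : Occ t (of t) unit
  | left {X X' : FreeSMC T} (a : Occ t X X') (Y : FreeSMC T) : Occ t (X.tensor Y) (X'.tensor Y)
  | right (X : FreeSMC T) {Y Y' : FreeSMC T} (a : Occ t Y Y') : Occ t (X.tensor Y) (X.tensor Y')

/-! ### Splitting off one occurrence of a letter. -/

namespace Occ

/-- Moving a letter to the front. -/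
def iso {t : T} : ∀ {X X' : FreeSMC T}, Occ t X X' → (X ≅ FreeSMC.of t ⊗ X')
  | _, _, .of => (ρ_ (FreeSMC.of t)).symm
  | _, _, .left a Y => whiskerRightIso a.iso Y ≪≫ α_ (FreeSMC.of t) _ Y
  | _, _, .right X a => whiskerLeftIso X a.iso ≪≫ moveFront X (FreeSMC.of t) _

/-- The position of an occurrence. -/
def pos {t : T} : ∀ {X X' : FreeSMC T}, Occ t X X' → Pos X
  | _, _, .of => ()
  | _, _, .left a _ => Sum.inl a.pos
  | _, _, .right _ a => Sum.inr a.pos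

/-- The inclusion of the remaining positions. -/
def emb {t : T} : ∀ {X X' : FreeSMC T}, Occ t X X' → Pos X' → Pos X
  | _, _, .of => Empty.elim
  | _, _, .left a _ => Sum.map a.emb id
  | _, _, .right _ a => Sum.map id a.emb

theorem emb_injective {t : T} {X X' : FreeSMC T} (a : Occ t X X') : Function.Injective a.emb := by
  induction a with
  | of => exact fun x => x.elim
  | left a Y h => exact h.sumMap Function.injective_id
  | right X a h => exact Function.injective_id.sumMap h

theorem len_eq {t : T} {X X' : FreeSMC T} (a : Occ t X X') : X.len = X'.len + 1 := by
  induction a with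
  | of => rfl
  | left a Y h => simp only [len, h]; omega
  | right X a h => simp only [len, h]; omega

/-- The position also determines the remaining word, which is what makes the residual morphisms of f
and g parallel. -/
theorem eq_of_pos_eq {t : T} {X X₁ X₂ : FreeSMC T} (a : Occ t X X₁) (b : Occ t X X₂)
    (h : a.pos = b.pos) : ∃ e : X₁ = X₂, e ▸ a = b := by
  induction a generalizing X₂ with
  | of => cases b; exact ⟨rfl, rfl⟩
  | left a Y ih =>
    cases b with
    | left b Y =>
      obtain ⟨rfl, rfl⟩ := ih b (Sum.inl_injective h)
      exact ⟨rfl, rfl⟩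
    | right X b => exact (Sum.inl_ne_inr h).elim
  | right X a ih =>
    cases b with
    | left b Y => exact (Sum.inr_ne_inl h).elim
    | right X b =>
      obtain ⟨rfl, rfl⟩ := ih b (Sum.inr_injective h)
      exact ⟨rfl, rfl⟩

/-- The morphism `f` carries the occurrence `a` to the occurrence `b`, and acts as `f'` on
the remaining letters. -/
structure Compat {t : T} {X X' Y Y' : FreeSMC T} (f : X ⟶ Y) (a : Occ t X X') (b : Occ t Y Y')
    (f' : X' ⟶ Y') : Prop where
  hom : f ≫ b.iso.hom = a.iso.hom ≫ FreeSMC.of t ◁ f'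
  pos : posMap f a.pos = b.pos
  emb : ∀ p, posMap f (a.emb p) = b.emb (posMap f' p)

/-- Inverse generators thereby need no computation of their own. -/
theorem Compat.inv {t : T} {X X' Y Y' : FreeSMC T} {f : X ≅ Y} {a : Occ t X X'} {b : Occ t Y Y'}
    {f' : X' ≅ Y'} (h : Compat f.hom a b f'.hom) : Compat f.inv b a f'.inv where
  hom := by
    rw [Iso.inv_comp_eq, ← Category.assoc, h.hom]
    simp
  pos := by rw [← h.pos, posMap_inv_hom]
  emb p := by
    obtain ⟨q, rfl⟩ := (posMap f'.hom).surjective p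
    rw [← h.emb, posMap_inv_hom, posMap_inv_hom]

theorem Compat.comp {t : T} {X X' Y Y' Z Z' : FreeSMC T} {f : X ⟶ Y} {g : Y ⟶ Z} {a : Occ t X X'}
    {b : Occ t Y Y'} {c : Occ t Z Z'} {f' : X' ⟶ Y'} {g' : Y' ⟶ Z'} (h : Compat f a b f')
    (k : Compat g b c g') : Compat (f ≫ g) a c (f' ≫ g') where
  hom := by rw [Category.assoc, k.hom, ← Category.assoc, h.hom]; simp
  pos := by rw [posMap_comp, Equiv.trans_apply, h.pos, k.pos]
  emb p := by rw [posMap_comp, Equiv.trans_apply, h.emb, k.emb, posMap_comp]; rfl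

theorem compat_id {t : T} {X X' : FreeSMC T} (a : Occ t X X') : Compat (𝟙 X) a a (𝟙 X') where
  hom := by simp
  pos := rfl
  emb _ := rfl

theorem Compat.tensor_left {t : T} {X X' Y Y' Z W : FreeSMC T} {f : X ⟶ Y} {a : Occ t X X'}
    {b : Occ t Y Y'} {f' : X' ⟶ Y'} (h : Compat f a b f') (g : Z ⟶ W) :
    Compat (f ⊗ₘ g) (a.left Z) (b.left W) (f' ⊗ₘ g) where
  hom := by
    change (f ⊗ₘ g) ≫ b.iso.hom ▷ W ≫ (α_ _ _ _).hom =
      (a.iso.hom ▷ Z ≫ (α_ _ _ _).hom) ≫ FreeSMC.of t ◁ (f' ⊗ₘ g)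
    rw [tensorHom_def', Category.assoc, ← comp_whiskerRight_assoc, h.hom]
    simp [tensorHom_def', whisker_exchange_assoc]
  pos := by
    rw [posMap_tensorHom]
    exact congrArg Sum.inl h.pos
  emb p := by
    rw [posMap_tensorHom, posMap_tensorHom]
    obtain p | p := p
    · exact congrArg Sum.inl (h.emb p)
    · rfl

theorem Compat.tensor_right {t : T} {X X' Y Y' Z W : FreeSMC T} {f : X ⟶ Y} {a : Occ t X X'}
    {b : Occ t Y Y'} {f' : X' ⟶ Y'} (h : Compat f a b f') (g : Z ⟶ W) :
    Compat (g ⊗ₘ f) (a.right Z) (b.right W) (g ⊗ₘ f') where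
  hom := by
    change (g ⊗ₘ f) ≫ W ◁ b.iso.hom ≫ (moveFront _ _ _).hom =
      (Z ◁ a.iso.hom ≫ (moveFront _ _ _).hom) ≫ FreeSMC.of t ◁ (g ⊗ₘ f')
    rw [Category.assoc, ← moveFront_naturality, MonoidalCategory.tensorHom_def, Category.assoc,
      ← whiskerLeft_comp_assoc, h.hom]
    simp only [MonoidalCategory.tensorHom_def, whiskerLeft_comp, Category.assoc,
      whisker_exchange_assoc]
  pos := by
    rw [posMap_tensorHom]
    exact congrArg Sum.inr h.pos
  emb p := by
    rw [posMap_tensorHom, posMap_tensorHom]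
    obtain p | p := p
    · rfl
    · exact congrArg Sum.inr (h.emb p)

theorem compat_associator_left {t : T} {X X' : FreeSMC T} (a : Occ t X X') (Y Z : FreeSMC T) :
    Compat (α_ X Y Z).hom ((a.left Y).left Z) (a.left (Y ⊗ Z)) (α_ X' Y Z).hom where
  hom := by
    change (α_ X Y Z).hom ≫ a.iso.hom ▷ (Y ⊗ Z) ≫ (α_ _ _ _).hom =
      ((a.iso.hom ▷ Y ≫ (α_ _ _ _).hom) ▷ Z ≫ (α_ _ _ _).hom) ≫ _
    simp only [comp_whiskerRight, Category.assoc, ← associator_front_left]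
    simp
  pos := rfl
  emb := by rintro ((p | p) | p) <;> rfl

theorem compat_associator_middle {t : T} (X : FreeSMC T) {Y Y' : FreeSMC T} (a : Occ t Y Y')
    (Z : FreeSMC T) :
    Compat (α_ X Y Z).hom ((a.right X).left Z) ((a.left Z).right X) (α_ X Y' Z).hom where
  hom := by
    change (α_ X Y Z).hom ≫ X ◁ (a.iso.hom ▷ Z ≫ (α_ _ _ _).hom) ≫ (moveFront _ _ _).hom =
      ((X ◁ a.iso.hom ≫ (moveFront _ _ _).hom) ▷ Z ≫ (α_ _ _ _).hom) ≫ _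
    simp only [comp_whiskerRight, Category.assoc, ← associator_front_middle]
    simp
  pos := rfl
  emb := by rintro ((p | p) | p) <;> rfl

theorem compat_associator_right {t : T} (X Y : FreeSMC T) {Z Z' : FreeSMC T} (a : Occ t Z Z') :
    Compat (α_ X Y Z).hom (a.right (X ⊗ Y)) ((a.right Y).right X) (α_ X Y Z').hom where
  hom := by
    change (α_ X Y Z).hom ≫ X ◁ (Y ◁ a.iso.hom ≫ (moveFront _ _ _).hom) ≫ (moveFront _ _ _).hom =
      ((X ⊗ Y) ◁ a.iso.hom ≫ (moveFront _ _ _).hom) ≫ _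
    simp only [Category.assoc, ← associator_front_right]
    simp
  pos := rfl
  emb := by rintro ((p | p) | p) <;> rfl

theorem compat_braiding_left {t : T} {X X' : FreeSMC T} (a : Occ t X X') (Y : FreeSMC T) :
    Compat (β_ X Y).hom (a.left Y) (a.right Y) (β_ X' Y).hom where
  hom := by
    change (β_ X Y).hom ≫ Y ◁ a.iso.hom ≫ (moveFront _ _ _).hom =
      (a.iso.hom ▷ Y ≫ (α_ _ _ _).hom) ≫ _
    rw [Category.assoc, ← braiding_front_left, BraidedCategory.braiding_naturality_left_assoc]
  pos := rfl
  emb := by rintro (p | p) <;> rfl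

theorem compat_braiding_right {t : T} (X : FreeSMC T) {Y Y' : FreeSMC T} (a : Occ t Y Y') :
    Compat (β_ X Y).hom (a.right X) (a.left X) (β_ X Y').hom where
  hom := by
    change (β_ X Y).hom ≫ a.iso.hom ▷ X ≫ (α_ _ _ _).hom =
      (X ◁ a.iso.hom ≫ (moveFront _ _ _).hom) ≫ _
    rw [Category.assoc, ← braiding_front_right, BraidedCategory.braiding_naturality_right_assoc]
  pos := rfl
  emb := by rintro (p | p) <;> rfl

theorem compat_leftUnitor {t : T} {X X' : FreeSMC T} (a : Occ t X X') :
    Compat (λ_ X).hom (a.right (𝟙_ _)) a (λ_ X').hom where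
  hom := by
    change (λ_ X).hom ≫ a.iso.hom = (𝟙_ _ ◁ a.iso.hom ≫ (moveFront _ _ _).hom) ≫ _
    rw [Category.assoc, ← leftUnitor_front, leftUnitor_naturality]
  pos := rfl
  emb := by rintro (p | p) <;> first | rfl | cases p

theorem compat_rightUnitor {t : T} {X X' : FreeSMC T} (a : Occ t X X') :
    Compat (ρ_ X).hom (a.left (𝟙_ _)) a (ρ_ X').hom where
  hom := by
    change (ρ_ X).hom ≫ a.iso.hom = (a.iso.hom ▷ 𝟙_ _ ≫ (α_ _ _ _).hom) ≫ _
    simp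
  pos := rfl
  emb := by rintro (p | p) <;> first | rfl | cases p

/-- The inductive step of coherence. For each generator, the residual morphism is the same generator
with a unit in place of the letter. -/
theorem exists_compat {X Y : FreeSMC T} (f : Pre X Y) {t : T} {X' : FreeSMC T} (a : Occ t X X') :
    ∃ (Y' : FreeSMC T) (b : Occ t Y Y') (f' : X' ⟶ Y'), Compat (⟦f⟧ : X ⟶ Y) a b f' := by
  induction f generalizing X' with
  | id X => exact ⟨_, _, _, compat_id a⟩
  | comp f g hf hg =>
    obtain ⟨_, b, _, h⟩ := hf a
    obtain ⟨_, c, _, k⟩ := hg b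
    exact ⟨_, _, _, h.comp k⟩
  | tensor f g hf hg =>
    cases a with
    | left a =>
      obtain ⟨_, b, _, h⟩ := hf a
      exact ⟨_, _, _, h.tensor_left ⟦g⟧⟩
    | right _ a =>
      obtain ⟨_, b, _, h⟩ := hg a
      exact ⟨_, _, _, h.tensor_right ⟦f⟧⟩
  | assoc X Y Z =>
    -- The surviving cases place the letter in X, Y or Z.
    obtain _ | ⟨_ | ⟨a, _⟩ | ⟨_, a⟩, _⟩ | ⟨_, a⟩ := a
    · exact ⟨_, _, _, compat_associator_left a Y Z⟩
    · exact ⟨_, _, _, compat_associator_middle X a Z⟩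
    · exact ⟨_, _, _, compat_associator_right X Y a⟩
  | assocInv X Y Z =>
    obtain _ | ⟨a, _⟩ | ⟨_, _ | ⟨a, _⟩ | ⟨_, a⟩⟩ := a
    · exact ⟨_, _, _, (compat_associator_left a Y Z).inv⟩
    · exact ⟨_, _, _, (compat_associator_middle X a Z).inv⟩
    · exact ⟨_, _, _, (compat_associator_right X Y a).inv⟩
  | left X =>
    obtain _ | ⟨⟨⟩, _⟩ | ⟨_, a⟩ := a
    exact ⟨_, _, _, compat_leftUnitor a⟩
  | leftInv X => exact ⟨_, _, _, (compat_leftUnitor a).inv⟩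
  | right X =>
    obtain _ | ⟨a, _⟩ | ⟨_, ⟨⟩⟩ := a
    exact ⟨_, _, _, compat_rightUnitor a⟩
  | rightInv X => exact ⟨_, _, _, (compat_rightUnitor a).inv⟩
  | symm X Y =>
    obtain _ | ⟨a, _⟩ | ⟨_, a⟩ := a
    · exact ⟨_, _, _, compat_braiding_left a Y⟩
    · exact ⟨_, _, _, compat_braiding_right X a⟩

end Occ

theorem noLetter_or_occ (X : FreeSMC T) :
    Nonempty (NoLetter X) ∨ ∃ (t : T) (X' : FreeSMC T), Nonempty (Occ t X X') := by
  induction X with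
  | of t => exact .inr ⟨t, _, ⟨.of⟩⟩
  | unit => exact .inl ⟨.unit⟩
  | tensor X Y hX hY =>
    obtain ⟨⟨a⟩⟩ | ⟨t, X', ⟨a⟩⟩ := hX
    · obtain ⟨⟨b⟩⟩ | ⟨t, Y', ⟨b⟩⟩ := hY
      · exact .inl ⟨a.tensor b⟩
      · exact .inr ⟨t, _, ⟨b.right X⟩⟩
    · exact .inr ⟨t, _, ⟨a.left Y⟩⟩

/-- Coherence for symmetric monoidal categories. -/
theorem hom_ext_of_posMap_eq {X Y : FreeSMC T} (f g : X ⟶ Y) (h : posMap f = posMap g) :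
    f = g := by
  -- The induction is on length, since the word left after removing a letter is not a subword; both
  -- ends change.
  induction hn : X.len generalizing X Y with
  | zero =>
    obtain ⟨⟨a⟩⟩ | ⟨t, X', ⟨a⟩⟩ := noLetter_or_occ X
    · induction f using Quotient.inductionOn with | _ f
      induction g using Quotient.inductionOn with | _ g
      obtain ⟨b, hb⟩ := a.exists_iso_naturality f
      obtain ⟨c, hc⟩ := a.exists_iso_naturality g
      -- Both morphisms are now compared through the same isomorphism from Y to the unit.
      obtain rfl := Subsingleton.elim b c
      exact (cancel_mono b.iso.hom).mp (hb.trans hc.symm)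
    · have := a.len_eq
      omega
  | succ n ih =>
    obtain ⟨⟨a⟩⟩ | ⟨t, X', ⟨a⟩⟩ := noLetter_or_occ X
    · have : X.len = 0 := by
        clear ih f g h hn
        induction a with
        | unit => rfl
        | tensor _ _ h₁ h₂ => simp only [len, h₁, h₂]
      omega
    · obtain ⟨Y₁, b, f', hf⟩ : ∃ (Y' : FreeSMC T) (b : Occ t Y Y') (f' : X' ⟶ Y'),
          Occ.Compat f a b f' := by
        induction f using Quotient.inductionOn
        exact Occ.exists_compat _ a
      obtain ⟨Y₂, c, g', hg⟩ : ∃ (Y' : FreeSMC T) (b : Occ t Y Y') (f' : X' ⟶ Y'),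
          Occ.Compat g a b f' := by
        induction g using Quotient.inductionOn
        exact Occ.exists_compat _ a
      obtain ⟨rfl, rfl⟩ := b.eq_of_pos_eq c (by rw [← hf.pos, ← hg.pos, h])
      have e : f' = g' := by
        -- Equality of positions is tested after embedding into Y, where f and g are known to agree.
        refine ih f' g' (Equiv.ext fun p => b.emb_injective ?_) ?_
        · rw [← hf.emb, ← hg.emb, h]
        · have := a.len_eq
          omega
      rw [← cancel_mono b.iso.hom, hf.hom, e]
      exact hg.hom.symm

theorem letterAt_posMap {X Y : FreeSMC T} (f : X ⟶ Y) (p : Pos X) :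
    letterAt Y (posMap f p) = letterAt X p := by
  induction f using Quotient.inductionOn with | _ f
  change letterAt Y (posPre f p) = letterAt X p
  induction f with
  | id => rfl
  | comp f g hf hg => exact (hg _).trans (hf p)
  | tensor f g hf hg =>
    obtain p | p := p
    · exact hf p
    · exact hg p
  | assoc => obtain (p | p) | p := p <;> rfl
  | assocInv => obtain p | p | p := p <;> rfl
  | left => obtain p | p := p <;> first | rfl | cases p
  | leftInv => rfl
  | right => obtain p | p := p <;> first | rfl | cases p
  | rightInv => rfl
  | symm => obtain p | p := p <;> rfl

end FreeSMC

/-! ### Formal morphisms preserve letters. -/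

namespace FreeStrong

section letters

variable {T : Type*}

theorem letterAt_posMap {X Y : FreeStrong T} (f : X ⟶ Y) (p : Pos X) :
    letterAt Y (posMap f p) = letterAt X p := by
  induction f using Quotient.inductionOn with | _ f
  change letterAt Y (posPre f p) = letterAt X p
  induction f with
  | id => rfl
  | comp f g hf hg => exact (hg _).trans (hf p)
  | tensor f g hf hg =>
    obtain p | p := p
    · exact hf p
    · exact hg p
  | assoc => obtain (p | p) | p := p <;> rfl
  | assocInv => obtain p | p | p := p <;> rfl
  | left => obtain p | p := p <;> first | rfl | cases p
  | leftInv => rfl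
  | right => obtain p | p := p <;> first | rfl | cases p
  | rightInv => rfl
  | symm => obtain p | p := p <;> rfl
  | map f => exact FreeSMC.letterAt_posMap f p
  | i => cases p
  | iInv => cases p
  | m => obtain p | p := p <;> rfl
  | mInv => obtain p | p := p <;> rfl

/-- Hence distinct letters in the target determine the permutation. -/
theorem letters_perm {X Y : FreeStrong T} (f : X ⟶ Y) (k : Fin X.len) :
    Y.letters (perm f k) = X.letters k := by
  simp [letters, perm, letterAt_posMap]

theorem posMap_eq_of_perm_eq {X Y : FreeStrong T} {f g : X ⟶ Y} (h : perm f = perm g) :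
    posMap f = posMap g := by
  ext p
  simpa [perm] using Equiv.congr_fun h (X.posEquiv p)

end letters

/-! ### Erasing `𝓕`: reduction to the free symmetric monoidal category. -/

section collapse

variable {T : Type*}

/-- The formal word obtained by erasing all occurrences of `𝓕`. -/
def collapse : FreeStrong T → FreeSMC T
  | app W => W
  | unit => 𝟙_ (FreeSMC T)
  | tensor X Y => collapse X ⊗ collapse Y

/-- Erasing the occurrences of `𝓕` does not change the positions. -/
def posCollapse : ∀ X : FreeStrong T, Pos X ≃ FreeSMC.Pos (collapse X)
  | app _ => Equiv.refl _
  | unit => Equiv.refl Empty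
  | tensor X Y => Equiv.sumCongr (posCollapse X) (posCollapse Y)

variable {C : Type*} [Category C] [MonoidalCategory C] [SymmetricCategory C]
  {D : Type*} [Category D] [MonoidalCategory D] [SymmetricCategory D]
  (F : C ⥤ D) [F.Braided] (φ : T → C)

open Functor.LaxMonoidal Functor.OplaxMonoidal

/-- The comparison of the value of a word with the value of its collapse. -/
def collapseIso :
    ∀ X : FreeStrong T, (lift F φ).obj X ≅ F.obj ((FreeSMC.lift φ).obj (collapse X))
  | app _ => Iso.refl _
  | unit => Functor.Monoidal.εIso F
  | tensor X Y => (collapseIso X ⊗ᵢ collapseIso Y) ≪≫ Functor.Monoidal.μIso F _ _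

/-- `k` is obtained from `f` by erasing the occurrences of `𝓕`. -/
structure Collapses {X Y : FreeStrong T} (f : X ⟶ Y) (k : collapse X ⟶ collapse Y) : Prop where
  hom : (lift F φ).map f ≫ (collapseIso F φ Y).hom =
    (collapseIso F φ X).hom ≫ F.map ((FreeSMC.lift φ).map k)
  pos : ∀ p, posCollapse Y (posMap f p) = FreeSMC.posMap k (posCollapse X p)

theorem posMap_comp {X Y Z : FreeStrong T} (f : X ⟶ Y) (g : Y ⟶ Z) :
    posMap (f ≫ g) = (posMap f).trans (posMap g) := by
  induction f using Quotient.inductionOn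
  induction g using Quotient.inductionOn
  rfl

theorem collapses_id (X : FreeStrong T) : Collapses F φ (𝟙 X) (𝟙 (collapse X)) where
  hom := by simp
  pos _ := rfl

theorem Collapses.comp {X Y Z : FreeStrong T} {f : X ⟶ Y} {g : Y ⟶ Z}
    {k : collapse X ⟶ collapse Y} {l : collapse Y ⟶ collapse Z} (hf : Collapses F φ f k)
    (hg : Collapses F φ g l) : Collapses F φ (f ≫ g) (k ≫ l) where
  hom := by simp [hg.hom, reassoc_of% hf.hom]
  pos p := by
    rw [posMap_comp, FreeSMC.posMap_comp, Equiv.trans_apply, Equiv.trans_apply, hg.pos, hf.pos]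

theorem Collapses.inv {X Y : FreeStrong T} {f : X ≅ Y} {k : collapse X ≅ collapse Y}
    (h : Collapses F φ f.hom k.hom) : Collapses F φ f.inv k.inv where
  hom := by
    rw [← Functor.mapIso_inv, Iso.inv_comp_eq, Functor.mapIso_hom, ← Category.assoc, h.hom,
      Category.assoc, ← F.map_comp, ← Functor.map_comp]
    simp
  pos p := by
    have e : posMap f.hom (posMap f.inv p) = p := by
      have e := posMap_comp f.inv f.hom
      rw [f.inv_hom_id] at e
      exact (Equiv.congr_fun e p).symm
    conv_rhs => rw [← e, h.pos, FreeSMC.posMap_inv_hom]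

theorem Collapses.tensor {X Y X' Y' : FreeStrong T} {f : X ⟶ Y} {g : X' ⟶ Y'}
    {k : collapse X ⟶ collapse Y} {l : collapse X' ⟶ collapse Y'} (hf : Collapses F φ f k)
    (hg : Collapses F φ g l) : Collapses F φ (f ⊗ₘ g) (k ⊗ₘ l) where
  hom := by
    induction f using Quotient.inductionOn with | _ f
    induction g using Quotient.inductionOn with | _ g
    induction k using Quotient.inductionOn with | _ k
    induction l using Quotient.inductionOn with | _ l
    -- Naturality of μ, stated for arbitrary objects so that rewriting does not meet values of
    -- words, which have the required form only by unfolding.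
    have h : ∀ {A B A' B' : D} {P Q P' Q' : C} (a : A ⟶ B) (a' : A' ⟶ B') (p : P ⟶ Q)
        (p' : P' ⟶ Q') (u : A ⟶ F.obj P) (v : B ⟶ F.obj Q) (u' : A' ⟶ F.obj P')
        (v' : B' ⟶ F.obj Q'), a ≫ v = u ≫ F.map p → a' ≫ v' = u' ≫ F.map p' →
        (a ⊗ₘ a') ≫ (v ⊗ₘ v') ≫ μ F Q Q' = ((u ⊗ₘ u') ≫ μ F P P') ≫ F.map (p ⊗ₘ p') := by
      intro A B A' B' P Q P' Q' a a' p p' u v u' v' h h'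
      rw [Category.assoc, ← μ_natural, tensorHom_comp_tensorHom_assoc,
        tensorHom_comp_tensorHom_assoc, h, h']
    exact h _ _ _ _ _ _ _ _ hf.hom hg.hom
  pos := by
    induction f using Quotient.inductionOn
    induction g using Quotient.inductionOn
    induction k using Quotient.inductionOn
    induction l using Quotient.inductionOn
    rintro (p | p)
    · exact congrArg Sum.inl (hf.pos p)
    · exact congrArg Sum.inr (hg.pos p)

theorem collapses_associator (X Y Z : FreeStrong T) :
    Collapses F φ (α_ X Y Z).hom (α_ (collapse X) (collapse Y) (collapse Z)).hom where
  hom := by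
    change (α_ _ _ _).hom ≫ ((collapseIso F φ X).hom ⊗ₘ
      (((collapseIso F φ Y).hom ⊗ₘ (collapseIso F φ Z).hom) ≫ μ F _ _)) ≫ μ F _ _ =
      (((((collapseIso F φ X).hom ⊗ₘ (collapseIso F φ Y).hom) ≫ μ F _ _) ⊗ₘ
        (collapseIso F φ Z).hom) ≫ μ F _ _) ≫ F.map (α_ _ _ _).hom
    have h : ∀ {X' Y' Z' : C} {X Y Z : D} (a : X ⟶ F.obj X') (b : Y ⟶ F.obj Y')
        (c : Z ⟶ F.obj Z'), (α_ X Y Z).hom ≫ (a ⊗ₘ ((b ⊗ₘ c) ≫ μ F _ _)) ≫ μ F _ _ =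
        ((((a ⊗ₘ b) ≫ μ F _ _) ⊗ₘ c) ≫ μ F _ _) ≫ F.map (α_ X' Y' Z').hom := by
      intro X' Y' Z' X Y Z a b c
      have h₁ : (a ⊗ₘ ((b ⊗ₘ c) ≫ μ F Y' Z')) = (a ⊗ₘ (b ⊗ₘ c)) ≫ F.obj X' ◁ μ F Y' Z' := by
        rw [← id_tensorHom, tensorHom_comp_tensorHom, Category.comp_id]
      have h₂ : (((a ⊗ₘ b) ≫ μ F X' Y') ⊗ₘ c) = ((a ⊗ₘ b) ⊗ₘ c) ≫ μ F X' Y' ▷ F.obj Z' := by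
        rw [← tensorHom_id, tensorHom_comp_tensorHom, Category.comp_id]
      rw [h₁, h₂, Category.assoc, Category.assoc, Category.assoc,
        Functor.LaxMonoidal.associativity, associator_naturality_assoc]
    exact h _ _ _
  pos := by rintro ((p | p) | p) <;> rfl

theorem collapses_leftUnitor (X : FreeStrong T) :
    Collapses F φ (λ_ X).hom (λ_ (collapse X)).hom where
  hom := by
    change (λ_ _).hom ≫ (collapseIso F φ X).hom =
      ((ε F ⊗ₘ (collapseIso F φ X).hom) ≫ μ F _ _) ≫ F.map (λ_ _).hom
    rw [← leftUnitor_naturality, Functor.LaxMonoidal.left_unitality, Category.assoc,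
      MonoidalCategory.tensorHom_def', Category.assoc]
  pos := by rintro (p | p) <;> first | rfl | cases p

theorem collapses_rightUnitor (X : FreeStrong T) :
    Collapses F φ (ρ_ X).hom (ρ_ (collapse X)).hom where
  hom := by
    change (ρ_ _).hom ≫ (collapseIso F φ X).hom =
      (((collapseIso F φ X).hom ⊗ₘ ε F) ≫ μ F _ _) ≫ F.map (ρ_ _).hom
    rw [← rightUnitor_naturality, Functor.LaxMonoidal.right_unitality, Category.assoc,
      MonoidalCategory.tensorHom_def, Category.assoc]
  pos := by rintro (p | p) <;> first | rfl | cases p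

theorem collapses_braiding (X Y : FreeStrong T) :
    Collapses F φ (β_ X Y).hom (β_ (collapse X) (collapse Y)).hom where
  hom := by
    change (β_ _ _).hom ≫ ((collapseIso F φ Y).hom ⊗ₘ (collapseIso F φ X).hom) ≫ μ F _ _ =
      (((collapseIso F φ X).hom ⊗ₘ (collapseIso F φ Y).hom) ≫ μ F _ _) ≫ F.map (β_ _ _).hom
    rw [Category.assoc, Functor.LaxBraided.braided, BraidedCategory.braiding_naturality_assoc]
  pos := by rintro (p | p) <;> rfl

/-- The comparison isomorphism at the formal unit already is ε, so nothing remains of i; likewise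
for m below. -/
theorem collapses_ε : Collapses F φ (ε (functor T)) (𝟙 (𝟙_ (FreeSMC T))) where
  hom := by
    change ε F ≫ 𝟙 _ = ε F ≫ F.map (𝟙 _)
    simp
  pos _ := rfl

theorem collapses_μ (V W : FreeSMC T) : Collapses F φ (μ (functor T) V W) (𝟙 (V ⊗ W)) where
  hom := by
    change μ F _ _ ≫ 𝟙 _ = ((𝟙 _ ⊗ₘ 𝟙 _) ≫ μ F _ _) ≫ F.map (𝟙 _)
    simp
  pos := by rintro (p | p) <;> rfl

theorem exists_collapses {X Y : FreeStrong T} (f : X ⟶ Y) : ∃ k, Collapses F φ f k := by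
  induction f using Quotient.inductionOn with | _ f
  induction f with
  | id X => exact ⟨_, collapses_id F φ X⟩
  | comp f g hf hg =>
    obtain ⟨_, hk⟩ := hf
    obtain ⟨_, hl⟩ := hg
    exact ⟨_, hk.comp F φ hl⟩
  | tensor f g hf hg =>
    obtain ⟨_, hk⟩ := hf
    obtain ⟨_, hl⟩ := hg
    exact ⟨_, hk.tensor F φ hl⟩
  | assoc X Y Z => exact ⟨_, collapses_associator F φ X Y Z⟩
  | assocInv X Y Z => exact ⟨_, (collapses_associator F φ X Y Z).inv⟩
  | left X => exact ⟨_, collapses_leftUnitor F φ X⟩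
  | leftInv X => exact ⟨_, (collapses_leftUnitor F φ X).inv⟩
  | right X => exact ⟨_, collapses_rightUnitor F φ X⟩
  | rightInv X => exact ⟨_, (collapses_rightUnitor F φ X).inv⟩
  | symm X Y => exact ⟨_, collapses_braiding F φ X Y⟩
  -- On words `𝓕(W)` the comparison isomorphism is the identity.
  | map f => exact ⟨f, (Category.comp_id _).trans (Category.id_comp _).symm, fun _ => rfl⟩
  | i => exact ⟨_, collapses_ε F φ⟩
  | iInv => exact ⟨_, Collapses.inv (f := Functor.Monoidal.εIso (functor T))
      (k := Iso.refl _) F φ (collapses_ε F φ)⟩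
  | m V W => exact ⟨_, collapses_μ F φ V W⟩
  | mInv V W => exact ⟨_, Collapses.inv (f := Functor.Monoidal.μIso (functor T) V W)
      (k := Iso.refl _) F φ (collapses_μ F φ V W)⟩

/-- Coherence for strong symmetric monoidal functors. -/
theorem lift_map_eq_of_perm_eq {X Y : FreeStrong T} (f g : X ⟶ Y) (h : perm f = perm g) :
    (lift F φ).map f = (lift F φ).map g := by
  obtain ⟨k, hk⟩ := exists_collapses F φ f
  obtain ⟨l, hl⟩ := exists_collapses F φ g
  have e : k = l := by
    refine FreeSMC.hom_ext_of_posMap_eq k l (Equiv.ext fun p => ?_)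
    obtain ⟨q, rfl⟩ := (posCollapse X).surjective p
    rw [← hk.pos, ← hl.pos, posMap_eq_of_perm_eq h]
  rw [← cancel_mono (collapseIso F φ Y).hom, hk.hom, hl.hom, e]

end collapse

end FreeStrong

/-! ### From formal morphisms to diagrams. -/

namespace FormalDiagram

variable {C : Type*} [Category C] [MonoidalCategory C] [SymmetricCategory C]
  {D : Type*} [Category D] [MonoidalCategory D] [SymmetricCategory D]
  {F : C ⥤ D} [F.Braided] {J : Type*} [Quiver J]

/-- Heterogeneous equality is needed because `fac` identifies the objects of the two diagrams only
propositionally; once it is substituted, this is functoriality along the path. -/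
theorem map_composePath_lift (G : FormalDiagram F J) {a b : J} (p : Quiver.Path a b) :
    HEq ((formalEval F).map (composePath (G.lift.mapPath p)))
      (composePath (G.diagram.mapPath p)) := by
  obtain ⟨diagram, lift, rfl⟩ := G
  refine heq_of_eq ?_
  induction p with
  | nil => exact (formalEval F).map_id _
  | cons p e ih =>
    exact ((formalEval F).map_comp _ _).trans (congrArg (· ≫ (formalEval F).map (lift.map e)) ih)

theorem diagramCommutes (G : FormalDiagram F J) (h : G.ExpectedToCommute) :
    DiagramCommutes G.diagram :=
  fun _ _ p q => eq_of_heq <| (G.map_composePath_lift p).symm.trans <|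
    (heq_of_eq (FreeStrong.lift_map_eq_of_perm_eq F id _ _ (h p q))).trans
      (G.map_composePath_lift q)

/-- Both permutations send place k to a place of the target word carrying the k-th letter of the
source, and there is at most one such place. -/
theorem DistinctObjects.expectedToCommute {G : FormalDiagram F J} (h : G.DistinctObjects) :
    G.ExpectedToCommute := fun _ b _ _ =>
  Equiv.ext fun _ => h b (by rw [FreeStrong.letters_perm, FreeStrong.letters_perm])

end FormalDiagram

theorem mainTheorem10 {C : Type*} [Category C] [MonoidalCategory C] [SymmetricCategory C]
    {D : Type*} [Category D] [MonoidalCategory D] [SymmetricCategory D]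
    (F : C ⥤ D) [F.Braided] :
    (∀ (J : Type*) [Quiver J] (G : FormalDiagram F J),
      G.ExpectedToCommute → DiagramCommutes G.diagram) ∧
    (∀ (V W : FreeStrong C) (f g : V ⟶ W), FreeStrong.perm f = FreeStrong.perm g →
      (formalEval F).map f = (formalEval F).map g) ∧
    (∀ (J : Type*) [Quiver J] (G : FormalDiagram F J),
      G.DistinctObjects → DiagramCommutes G.diagram) :=
  ⟨fun _ _ G h => G.diagramCommutes h, fun _ _ f g h => FreeStrong.lift_map_eq_of_perm_eq F id f g h,
    fun _ _ G h => G.diagramCommutes h.expectedToCommute⟩
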